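/- Let $(\Omega,\mathcal F,\mathbb P)$ be a complete probability space carrying a standard $n$-dimensional Brownian motion $W=(W_s)_{s\ge 0}$, and let $\mathbb F=(\mathcal F_s)_{s\ge0}$ be the right-continuous completion of the filtration generated by $W$. Let $\mathbb U\subset\mathbb R^m$ be compact, and let $f:\mathbb R^n\times\mathbb U\to\mathbb R^n$ and $\sigma:\mathbb R^n\times\mathbb U\to\mathbb R^{n\times n}$ be continuous, and Lipschitz in the first argument uniformly with respect to the second. Let $\mathcal U$ be the set of $\mathbb F$-progressively measurable processes $u=(u_s)_{s\ge0}$ with values in $\mathbb U$. For $t\ge 0$, $x\in\mathbb R^n$ and $u\in\mathcal U$ let $X^{t,x;u}$ denote the strong solution (an $\mathbb F$-adapted process with almost surely continuous paths, unique up to indistinguishability) of $$dX_s=f(X_s,u_s)\,ds+\sigma(X_s,u_s)\,dW_s,\quad s\ge t,\qquad X_t=x,$$ extended by $X^{t,x;u}_s:=x$ for $s\in[0,t]$. Let $A,B\subset\mathbb R^n$ be closed and disjoint, let $0\le t\le T<\infty$ and let $p\ge 0$. With $\tau_{A\cup B}:=\inf\{s\ge t: X^{t,x;u}_s\in A\cup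 B\}$ ($\inf\emptyset=\infty$) and $\bar\tau:=\tau_{A\cup B}\wedge T$, put $$\mathrm{RA}(t,p;A,B):=\Big\{x\in\mathbb R^n:\ \exists u\in\mathcal U,\ \mathbb P\big(\exists s\in[t,T]:\ X^{t,x;u}_s\in A\ \text{and}\ X^{t,x;u}_r\notin B\ \ \forall r\in[t,s]\big)>p\Big\},$$ $$V_1(t,x):=\sup_{u\in\mathcal U}\mathbb E\big[\mathbf 1_A(X^{t,x;u}_{\bar\tau})\big].$$ Then the event in the definition of $\mathrm{RA}$ is measurable and the random variable $\mathbf 1_A(X^{t,x;u}_{\bar\tau})$ is integrable for all $x\in\mathbb R^n$ and $u\in\mathcal U$, so that both objects are well defined, and $$\mathrm{RA}(t,p;A,B)=\{x\in\mathbb R^n:\ V_1(t,x)>p\}.$$ -/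

import Mathlib

open MeasureTheory ProbabilityTheory Filter Topology
open scoped NNReal ENNReal

namespace ReachAvoid

/-- The Euclidean space of dimension `n`. -/
abbrev E (n : ℕ) : Type := EuclideanSpace ℝ (Fin n)

section Brownian

variable {Ω : Type*} [MeasurableSpace Ω] {n : ℕ}

/-- A standard `n`-dimensional Brownian motion: measurable at each time, with independent
coordinates that are standard one-dimensional Brownian motions. -/
structure IsBrownianMotion (W : ℝ≥0 → Ω → E n) (P : Measure Ω) : Prop where
  measurable : ∀ s, Measurable (W s)
  isBrownianReal : ∀ i, IsBrownianReal (fun s ω => W s ω i) P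
  indep : iIndepFun (fun (i : Fin n) (ω : Ω) (s : ℝ≥0) => W s ω i) P

/-- The filtration generated by the process `W` and by all the `P`-null sets. -/
def completedFiltration (W : ℝ≥0 → Ω → E n) (P : Measure Ω) [P.IsComplete]
    (hW : ∀ s, Measurable (W s)) : Filtration ℝ≥0 (inferInstance : MeasurableSpace Ω) where
  seq s := (⨆ r ≤ s, MeasurableSpace.comap (W r) inferInstance) ⊔
    MeasurableSpace.generateFrom {N : Set Ω | P N = 0}
  mono' _ _ hst :=
    sup_le_sup_right (iSup₂_le fun r hr =>
      le_iSup₂ (f := fun r _ => MeasurableSpace.comap (W r) inferInstance) r (hr.trans hst)) _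
  le' _ := sup_le (iSup₂_le fun r _ => (hW r).comap_le)
    (MeasurableSpace.generateFrom_le fun _ hN => Measure.IsComplete.out' _ hN)

/-- The right-continuous completion of the filtration generated by `W`. -/
noncomputable def augmentedFiltration (W : ℝ≥0 → Ω → E n) (P : Measure Ω) [P.IsComplete]
    (hW : ∀ s, Measurable (W s)) : Filtration ℝ≥0 (inferInstance : MeasurableSpace Ω) :=
  (completedFiltration W P hW).rightCont

end Brownian

section Ito

variable {Ω : Type*} {mΩ : MeasurableSpace Ω}

/-- A simple process `H_s = ∑ k, ξ k * 1_{(a k, b k]}(s)`, where `ξ k` is a bounded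
`𝓕 (a k)`-measurable real random variable. -/
structure SimpleProcess (𝓕 : Filtration ℝ≥0 mΩ) where
  size : ℕ
  a : Fin size → ℝ≥0
  b : Fin size → ℝ≥0
  a_le_b : ∀ k, a k ≤ b k
  ξ : Fin size → Ω → ℝ
  measurable_ξ : ∀ k, Measurable[𝓕 (a k)] (ξ k)
  bounded_ξ : ∃ C : ℝ, ∀ k ω, |ξ k ω| ≤ C

/-- The value of a simple process at time `s`. -/
noncomputable def SimpleProcess.value {𝓕 : Filtration ℝ≥0 mΩ} (H : SimpleProcess 𝓕)
    (s : ℝ≥0) (ω : Ω) : ℝ :=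
  ∑ k, (Set.Ioc (H.a k) (H.b k)).indicator (fun _ => H.ξ k ω) s

/-- The elementary stochastic integral `∫_0^s H dB` of a simple process. -/
noncomputable def SimpleProcess.integral {𝓕 : Filtration ℝ≥0 mΩ} (H : SimpleProcess 𝓕)
    (B : ℝ≥0 → Ω → ℝ) (s : ℝ≥0) (ω : Ω) : ℝ :=
  ∑ k, H.ξ k ω * (B (min (H.b k) s) ω - B (min (H.a k) s) ω)

/-- `M` is the Itô integral process `s ↦ ∫_0^s H dB` of the integrand `H` with respect to the
Brownian motion `B`: for some sequence of simple processes `S k` one has, on every time interval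
`[0, R]`, both `∫_0^R |S k - H|² ds → 0` in probability and `∫ S k dB → M` uniformly on `[0, R]`
in probability. -/
def IsItoIntegral (𝓕 : Filtration ℝ≥0 mΩ) (P : Measure Ω) (B H M : ℝ≥0 → Ω → ℝ) : Prop :=
  (∀ᵐ ω ∂P, Measurable fun s => H s ω) ∧
  ∃ S : ℕ → SimpleProcess 𝓕, ∀ R : ℝ≥0, ∀ ε : ℝ≥0∞, 0 < ε →
    Tendsto (fun k => P {ω | ε ≤ ∫⁻ s in Set.Icc (0 : ℝ) R,
      ‖(S k).value s.toNNReal ω - H s.toNNReal ω‖ₑ ^ 2})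
      atTop (𝓝 0) ∧
    Tendsto (fun k => P {ω | ε ≤ ⨆ s ∈ Set.Icc 0 R, ‖(S k).integral B s ω - M s ω‖ₑ})
      atTop (𝓝 0)

end Ito

section Control

variable {Ω : Type*} {mΩ : MeasurableSpace Ω} {n m : ℕ} {U : Set (E m)}

/-- `X` is a strong solution, for the control `u` and the initial condition `(t, x)`, of
`dX_s = f(X_s, u_s) ds + σ(X_s, u_s) dW_s`, `s ≥ t`, `X_t = x`, extended by `X_s = x` for `s ≤ t`:
it is adapted to `𝓕`, has almost surely continuous paths, and almost surely satisfies the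
integral equation, coordinate by coordinate, at all times. `M i j` is the Itô integral
`∫_t^s σ_{ij}(X_r, u_r) dW^j_r`. -/
structure IsStrongSolution (𝓕 : Filtration ℝ≥0 mΩ) (P : Measure Ω) (W : ℝ≥0 → Ω → E n)
    (f : E n → U → E n) (σ : E n → U → Matrix (Fin n) (Fin n) ℝ)
    (u : ℝ≥0 → Ω → U) (t : ℝ≥0) (x : E n) (X : ℝ≥0 → Ω → E n) : Prop where
  adapted : Adapted 𝓕 X
  continuous_paths : ∀ᵐ ω ∂P, Continuous fun s => X s ω
  initial : ∀ s ≤ t, ∀ ω, X s ω = x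
  equation : ∃ M : Fin n → Fin n → ℝ≥0 → Ω → ℝ,
    (∀ i j, IsItoIntegral 𝓕 P (fun s ω => W s ω j)
      (fun s ω => (Set.Ioi t).indicator (fun r => σ (X r ω) (u r ω) i j) s) (M i j)) ∧
    ∀ᵐ ω ∂P, ∀ s, t ≤ s → ∀ i,
      X s ω i = x i + (∫ r in (t : ℝ)..s, f (X r.toNNReal ω) (u r.toNNReal ω)) i + ∑ j, M i j s ω

/-- The event that `X` hits `A` at some time `s ∈ [t, T]`, and stays out of `B` on `[t, s]`. -/
def reachAvoidEvent (A B : Set (E n)) (t T : ℝ≥0) (X : ℝ≥0 → Ω → E n) : Set Ω :=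
  {ω | ∃ s ∈ Set.Icc t T, X s ω ∈ A ∧ ∀ r ∈ Set.Icc t s, X r ω ∉ B}

/-- The reach-avoid set `RA(t, p; A, B)`. -/
def reachAvoidSet (𝓕 : Filtration ℝ≥0 mΩ) (P : Measure Ω) (W : ℝ≥0 → Ω → E n)
    (f : E n → U → E n) (σ : E n → U → Matrix (Fin n) (Fin n) ℝ)
    (A B : Set (E n)) (T t : ℝ≥0) (p : ℝ) : Set (E n) :=
  {x | ∃ u : ℝ≥0 → Ω → U, IsProgressive 𝓕 u ∧
    ∃ X, IsStrongSolution 𝓕 P W f σ u t x X ∧ p < P.real (reachAvoidEvent A B t T X)}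

/-- The payoff `1_A(X_τ)`, where `τ = τ_{A ∪ B} ∧ T` and `τ_{A ∪ B}` is the first entry time
of `X` to `A ∪ B` after time `t`. -/
noncomputable def payoff (A B : Set (E n)) (t T : ℝ≥0) (X : ℝ≥0 → Ω → E n) (ω : Ω) : ℝ :=
  A.indicator (fun _ => 1)
    (stoppedValue X (fun ω => min (hittingAfter X (A ∪ B) t ω) (T : WithTop ℝ≥0)) ω)

/-- The value function `V₁(t, x)`: the supremum over the admissible controls of the expected
payoff of the corresponding solution. -/
noncomputable def valueFunction (𝓕 : Filtration ℝ≥0 mΩ) (P : Measure Ω) (W : ℝ≥0 → Ω → E n)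
    (f : E n → U → E n) (σ : E n → U → Matrix (Fin n) (Fin n) ℝ)
    (A B : Set (E n)) (T t : ℝ≥0) (x : E n) : ℝ :=
  sSup {J | ∃ u : ℝ≥0 → Ω → U, IsProgressive 𝓕 u ∧
    ∃ X, IsStrongSolution 𝓕 P W f σ u t x X ∧ J = ∫ ω, payoff A B t T X ω ∂P}

end Control

end ReachAvoid

namespace ReachAvoid

open Metric

/-! Along a continuous path the entry time into the closed set `A ∪ B` is attained, and the path
sits in `A` at that time exactly when it reaches `A` before `B`. Hence the payoff is almost surely
the indicator of the reach-avoid event, and its expectation is the probability of that event. A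
supremum exceeds `p` iff one of its members does, so the two sets agree. Both sides range over all
controls and their solutions, so existence and uniqueness of solutions play no role. The delicate
point is measurability, since the event quantifies over uncountably many times.
`exists_mem_forall_notMem_iff_dense` reduces it to countably many. -/

/-- A continuous curve reaches the closed set `A` while staying out of the disjoint closed set `B`
iff along a dense set of times it comes arbitrarily close to `A` while staying uniformly away
from `B`. -/
theorem exists_mem_forall_notMem_iff_dense {ι Y : Type*} [LinearOrder ι] [TopologicalSpace ι]
    [OrderTopology ι] [CompactSpace ι] [PseudoEMetricSpace Y] {g : ι → Y} (hg : Continuous g)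
    {A B : Set Y} (hA : IsClosed A) (hB : IsClosed B) (hAB : Disjoint A B) {D : Set ι}
    (hD : Dense D) :
    (∃ s, g s ∈ A ∧ ∀ r ≤ s, g r ∉ B) ↔
      ∃ k : ℕ, ∀ l : ℕ, ∃ q ∈ D, infEDist (g q) A < (l : ℝ≥0∞)⁻¹ ∧
        ∀ r ∈ D, r ≤ q → (k : ℝ≥0∞)⁻¹ < infEDist (g r) B := by
  have hcA : Continuous fun r => infEDist (g r) A := continuous_infEDist.comp hg
  have hcB : Continuous fun r => infEDist (g r) B := continuous_infEDist.comp hg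
  constructor
  · rintro ⟨s, hsA, hsB⟩
    -- Compactness of `Iic s` turns avoidance of `B` into one bound `k⁻¹` valid up to time `s`.
    obtain ⟨r₀, hr₀, hmin⟩ := (isClosed_Iic (a := s)).isCompact.exists_isMinOn
      ⟨s, Set.mem_Iic.2 le_rfl⟩ hcB.continuousOn
    have hpos : infEDist (g r₀) B ≠ 0 := fun h =>
      hsB r₀ hr₀ (hB.closure_eq ▸ mem_closure_iff_infEDist_zero.2 h)
    obtain ⟨k, hk⟩ := ENNReal.exists_inv_nat_lt hpos
    have hO : IsOpen {r | (k : ℝ≥0∞)⁻¹ < infEDist (g r) B} := isOpen_lt continuous_const hcB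
    have hle : ∀ r ≤ s, (k : ℝ≥0∞)⁻¹ < infEDist (g r) B := fun r hr => hk.trans_le (hmin hr)
    refine ⟨k, fun l => ?_⟩
    -- A time of `D` near `s` may exceed `s`; the strict bound is an open condition, so it persists
    -- on `[s, q]`.
    have hnear : ∀ᶠ q in 𝓝 s, Set.Icc s q ⊆ {r | (k : ℝ≥0∞)⁻¹ < infEDist (g r) B} :=
      (Filter.Tendsto.Icc tendsto_const_nhds tendsto_id).eventually
        (Filter.eventually_smallSets_subset.2 (hO.mem_nhds (hle s le_rfl)))
    have hclose : ∀ᶠ q in 𝓝 s, infEDist (g q) A < (l : ℝ≥0∞)⁻¹ := by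
      refine hcA.continuousAt.eventually_lt continuousAt_const ?_
      simp [infEDist_zero_of_mem hsA]
    obtain ⟨q, hqD, hq₁, hq₂⟩ := hD.inter_nhds_nonempty (hnear.and hclose)
    refine ⟨q, hqD, hq₂, fun r _ hr => ?_⟩
    rcases le_total r s with h | h
    · exact hle r h
    · exact hq₁ ⟨h, hr⟩
  · rintro ⟨k, hk⟩
    choose q hqD hqA hqB using hk
    obtain ⟨s, hs⟩ := exists_clusterPt_of_compactSpace (map q atTop)
    have hs' : MapClusterPt s atTop q := hs
    have hsA : g s ∈ A := by
      rw [← hA.closure_eq, mem_closure_iff_infEDist_zero]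
      have hlim : Tendsto (fun l => infEDist (g (q l)) A) atTop (𝓝 0) :=
        tendsto_of_tendsto_of_tendsto_of_le_of_le tendsto_const_nhds
          ENNReal.tendsto_inv_nat_nhds_zero (fun _ => zero_le) fun l => (hqA l).le
      -- The distances to `A` tend to `0` along `q` and cluster at the distance from `g s`, which is
      -- therefore `0`.
      have hcl := hs'.continuousAt_comp hcA.continuousAt
      exact eq_of_nhds_neBot (hcl.neBot.mono (inf_le_inf_left _ hlim))
    refine ⟨s, hsA, fun r hr hrB => ?_⟩
    rcases hr.eq_or_lt with rfl | hlt
    · exact Set.disjoint_left.1 hAB hsA hrB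
    have hO : IsOpen {r' | infEDist (g r') B < (k : ℝ≥0∞)⁻¹} := isOpen_lt hcB continuous_const
    -- If `g r ∈ B` with `r < s`, some `r' < s` in `D` is too close to `B`; infinitely many `q l`
    -- lie beyond `r'`, against their bound.
    obtain ⟨r', ⟨hr'B, hr's⟩, hr'D⟩ := hD.inter_open_nonempty _ (hO.inter isOpen_Iio)
      ⟨r, by simp [infEDist_zero_of_mem hrB], hlt⟩
    obtain ⟨l, hl⟩ := (hs'.frequently (isOpen_Ioi.mem_nhds hr's)).exists
    exact (hqB l r' hr'D (le_of_lt hl)).not_gt hr'B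

section Path

variable {Ω : Type*} {n : ℕ} {A B : Set (E n)} {t T : ℝ≥0} {X : ℝ≥0 → Ω → E n} {ω : Ω}

/-- With `Set.Icc t T` as index type, time is a compact linear order, as the dense-times criterion
requires. -/
theorem mem_reachAvoidEvent_iff_subtype :
    ω ∈ reachAvoidEvent A B t T X ↔
      ∃ s : Set.Icc t T, X s ω ∈ A ∧ ∀ r ≤ s, X r ω ∉ B := by
  constructor
  · rintro ⟨s, hs, hsA, hsB⟩
    exact ⟨⟨s, hs⟩, hsA, fun r hr => hsB r ⟨r.2.1, hr⟩⟩
  · rintro ⟨s, hsA, hsB⟩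
    exact ⟨s, s.2, hsA, fun r hr => hsB ⟨r, hr.1, hr.2.trans s.2.2⟩ hr.2⟩

/-- Along a continuous path, the payoff is the indicator of the reach-avoid event. -/
theorem payoff_eq_indicator_reachAvoidEvent (hA : IsClosed A) (hB : IsClosed B)
    (hAB : Disjoint A B) (ht : t ≤ T) (hX : Continuous fun s => X s ω) :
    payoff A B t T X ω = (reachAvoidEvent A B t T X).indicator (fun _ => 1) ω := by
  have key : stoppedValue X
      (fun ω => min (hittingAfter X (A ∪ B) t ω) (T : WithTop ℝ≥0)) ω ∈ A ↔
      ω ∈ reachAvoidEvent A B t T X := by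
    by_cases hex : ∃ s ∈ Set.Icc t T, X s ω ∈ A ∪ B
    · obtain ⟨s₀, hs₀, hs₀AB⟩ := hex
      set H : Set ℝ≥0 := {s | t ≤ s ∧ X s ω ∈ A ∪ B} with hH
      have hne : H.Nonempty := ⟨s₀, hs₀.1, hs₀AB⟩
      have hcl : IsClosed H := isClosed_Ici.inter ((hA.union hB).preimage hX)
      -- Closedness makes the entry time attained.
      have hmem : sInf H ∈ H := hcl.csInf_mem hne (OrderBot.bddBelow H)
      have hle : ∀ s ∈ H, sInf H ≤ s := fun s hs => csInf_le (OrderBot.bddBelow H) hs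
      have hleT : sInf H ≤ T := (hle s₀ ⟨hs₀.1, hs₀AB⟩).trans hs₀.2
      have hhit : hittingAfter X (A ∪ B) t ω = ((sInf H : ℝ≥0) : WithTop ℝ≥0) := by
        rw [hittingAfter_def]
        exact if_pos hne
      have hval : stoppedValue X
          (fun ω => min (hittingAfter X (A ∪ B) t ω) (T : WithTop ℝ≥0)) ω = X (sInf H) ω := by
        rw [stoppedValue, hhit, min_eq_left (WithTop.coe_le_coe.2 hleT), WithTop.untopA, WithTop.untopD_coe]
      rw [hval]
      constructor
      · intro h
        refine ⟨sInf H, ⟨hmem.1, hleT⟩, h, fun r hr hrB => ?_⟩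
        have hr' : r = sInf H := le_antisymm hr.2 (hle r ⟨hr.1, Or.inr hrB⟩)
        exact Set.disjoint_left.1 hAB h (hr' ▸ hrB)
      · rintro ⟨s, hs, hsA, hsB⟩
        -- The entry time is at most `s`, so the path is outside `B` there and must be in `A`.
        exact hmem.2.resolve_right (hsB _ ⟨hmem.1, hle s ⟨hs.1, Or.inl hsA⟩⟩)
    · push Not at hex
      -- Without an entry the path is stopped at `T`, outside `A`, and both sides are false.
      have hTle : (T : WithTop ℝ≥0) ≤ hittingAfter X (A ∪ B) t ω := by
        by_contra! h
        obtain ⟨s, hs, hsAB⟩ := hittingAfter_lt_iff.1 h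
        exact hex s ⟨hs.1, hs.2.le⟩ hsAB
      rw [stoppedValue, min_eq_right hTle, WithTop.untopA, WithTop.untopD_coe]
      exact ⟨fun h => absurd (Or.inl h) (hex T ⟨ht, le_rfl⟩),
        fun ⟨s, hs, hsA, _⟩ => absurd (Or.inl hsA) (hex s hs)⟩
  unfold payoff
  by_cases h : ω ∈ reachAvoidEvent A B t T X
  · rw [Set.indicator_of_mem h, Set.indicator_of_mem (key.2 h)]
  · rw [Set.indicator_of_notMem h, Set.indicator_of_notMem (mt key.1 h)]

end Path

section Measurability

variable {Ω : Type*} [MeasurableSpace Ω] {P : Measure Ω} {n : ℕ} {A B : Set (E n)} {t T : ℝ≥0}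
  {X : ℝ≥0 → Ω → E n}

/-- The reach-avoid event of a process with almost surely continuous paths is measurable for a
complete measure. -/
theorem measurableSet_reachAvoidEvent [P.IsComplete] (hA : IsClosed A) (hB : IsClosed B)
    (hAB : Disjoint A B) (hX : ∀ s, Measurable (X s))
    (hXc : ∀ᵐ ω ∂P, Continuous fun s => X s ω) :
    MeasurableSet (reachAvoidEvent A B t T X) := by
  obtain ⟨D, hDc, hD⟩ := TopologicalSpace.exists_countable_dense (Set.Icc t T)
  have hS : MeasurableSet {ω | ∃ k : ℕ, ∀ l : ℕ, ∃ q ∈ D,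
      infEDist (X q ω) A < (l : ℝ≥0∞)⁻¹ ∧
        ∀ r ∈ D, r ≤ q → (k : ℝ≥0∞)⁻¹ < infEDist (X r ω) B} := by
    have hlt (q : Set.Icc t T) (l : ℕ) :
        MeasurableSet {ω | infEDist (X q ω) A < (l : ℝ≥0∞)⁻¹} :=
      measurableSet_lt (hX q).infEDist measurable_const
    have hgt (r : Set.Icc t T) (k : ℕ) :
        MeasurableSet {ω | (k : ℝ≥0∞)⁻¹ < infEDist (X r ω) B} :=
      measurableSet_lt measurable_const (hX r).infEDist
    have hunion : MeasurableSet (⋃ k : ℕ, ⋂ l : ℕ, ⋃ q ∈ D,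
        {ω | infEDist (X q ω) A < (l : ℝ≥0∞)⁻¹} ∩
          ⋂ r ∈ D, ⋂ _ : r ≤ q, {ω | (k : ℝ≥0∞)⁻¹ < infEDist (X r ω) B}) :=
      MeasurableSet.iUnion fun k => MeasurableSet.iInter fun l =>
        MeasurableSet.biUnion hDc fun q _ => (hlt q l).inter <|
          MeasurableSet.biInter hDc fun r _ => MeasurableSet.iInter fun _ => hgt r k
    convert hunion using 1
    ext ω
    simp only [Set.mem_iUnion, Set.mem_iInter, Set.mem_inter_iff, Set.mem_ofPred_eq, exists_prop]
  -- The two events agree off the null set of discontinuous paths, which completeness absorbs.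
  refine (hS.nullMeasurableSet.congr (μ := P) ?_).measurable_of_complete
  filter_upwards [hXc] with ω hω
  refine propext (Iff.symm ?_)
  exact mem_reachAvoidEvent_iff_subtype.trans (exists_mem_forall_notMem_iff_dense
    (g := fun s : Set.Icc t T => X s ω) (hω.comp continuous_subtype_val) hA hB hAB hD)

theorem payoff_ae_eq_indicator (hA : IsClosed A) (hB : IsClosed B) (hAB : Disjoint A B)
    (ht : t ≤ T) (hXc : ∀ᵐ ω ∂P, Continuous fun s => X s ω) :
    payoff A B t T X =ᵐ[P] (reachAvoidEvent A B t T X).indicator (fun _ => 1) := by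
  filter_upwards [hXc] with ω hω
  exact payoff_eq_indicator_reachAvoidEvent hA hB hAB ht hω

end Measurability

end ReachAvoid

open ReachAvoid in
theorem mainTheorem7 {Ω : Type*} [MeasurableSpace Ω] (P : Measure Ω) [IsProbabilityMeasure P]
    [P.IsComplete] {n m : ℕ} (W : ℝ≥0 → Ω → E n) (hW : IsBrownianMotion W P)
    (U : Set (E m)) (hU : IsCompact U)
    (f : E n → U → E n) (σ : E n → U → Matrix (Fin n) (Fin n) ℝ)
    (hf : Continuous (Function.uncurry f))
    (hfLip : ∃ K : ℝ≥0, ∀ v : U, LipschitzWith K fun x => f x v)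
    (hσ : Continuous (Function.uncurry σ))
    (hσLip : ∃ K : ℝ≥0, ∀ (v : U) (i j : Fin n), LipschitzWith K fun x => σ x v i j)
    (A B : Set (E n)) (hA : IsClosed A) (hB : IsClosed B) (hAB : Disjoint A B)
    (T t : ℝ≥0) (ht : t ≤ T) (p : ℝ) (hp : 0 ≤ p) :
    (∀ (x : E n) (u : ℝ≥0 → Ω → U) (X : ℝ≥0 → Ω → E n),
      IsProgressive (augmentedFiltration W P hW.measurable) u →
      IsStrongSolution (augmentedFiltration W P hW.measurable) P W f σ u t x X →
        MeasurableSet (reachAvoidEvent A B t T X) ∧ Integrable (payoff A B t T X) P) ∧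
    reachAvoidSet (augmentedFiltration W P hW.measurable) P W f σ A B T t p =
      {x | valueFunction (augmentedFiltration W P hW.measurable) P W f σ A B T t x > p} := by
  set 𝓕 := augmentedFiltration W P hW.measurable
  have hmeas : ∀ {x : E n} {u : ℝ≥0 → Ω → U} {X : ℝ≥0 → Ω → E n},
      IsStrongSolution 𝓕 P W f σ u t x X → MeasurableSet (reachAvoidEvent A B t T X) :=
    fun hX => measurableSet_reachAvoidEvent (P := P) hA hB hAB
      (fun s => (hX.adapted s).mono (𝓕.le s) le_rfl) hX.continuous_paths
  have hint : ∀ {x : E n} {u : ℝ≥0 → Ω → U} {X : ℝ≥0 → Ω → E n},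
      IsStrongSolution 𝓕 P W f σ u t x X →
        ∫ ω, payoff A B t T X ω ∂P = P.real (reachAvoidEvent A B t T X) := by
    intro x u X hX
    rw [integral_congr_ae (payoff_ae_eq_indicator hA hB hAB ht hX.continuous_paths)]
    exact integral_indicator_one (hmeas hX)
  refine ⟨fun x u X _ hX => ⟨hmeas hX, ?_⟩, ?_⟩
  · exact ((integrable_const (1 : ℝ)).indicator (hmeas hX)).congr
      (payoff_ae_eq_indicator hA hB hAB ht hX.continuous_paths).symm
  · ext x
    constructor
    · rintro ⟨u, hu, X, hX, hpX⟩
      -- The real supremum needs an upper bound: every payoff expectation is a probability, hence at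
      -- most `1`.
      refine (hint hX ▸ hpX).trans_le (le_csSup ⟨1, ?_⟩ ⟨u, hu, X, hX, rfl⟩)
      rintro J ⟨u', -, X', hX', rfl⟩
      exact (hint hX').trans_le measureReal_le_one
    · intro hx
      have hx' : p < valueFunction 𝓕 P W f σ A B T t x := hx
      rw [valueFunction] at hx'
      -- Were there no admissible pair, the value would be `sSup ∅ = 0`, which cannot exceed `p ≥
      -- 0`.
      obtain ⟨J, ⟨u, hu, X, hX, rfl⟩, hJ⟩ := exists_lt_of_lt_csSup
        (Set.nonempty_iff_ne_empty.2 fun h => hp.not_gt (by rwa [h, Real.sSup_empty] at hx')) hx'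
      exact ⟨u, hu, X, hX, hint hX ▸ hJ⟩
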